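/- For real $\nu$ and $x>0$ let $K_\nu(x)=\int_0^\infty e^{-x\cosh t}\cosh(\nu t)\,dt$ be the modified Bessel function of the second kind. For real $\alpha$ put $\tau=\nu-(\alpha+1)/2$, $$\varphi_\alpha(\nu,x)=\nu-\tfrac12-\frac{\tau}{2\sqrt{\tau^2+x^2}},\qquad D_\alpha(\nu,x)=\frac{x}{\varphi_\alpha(\nu,x)+\sqrt{\varphi_\alpha(\nu,x)^2+x^2}} .$$ (a) For all $\nu\ge 1/2$ and $x>0$, $$D_{2\nu-1}(\nu,x)\le \frac{K_{\nu-1}(x)}{K_\nu(x)}\le D_0(\nu,x),$$ and each of the two inequalities is an equality if and only if $\nu=1/2$. (b) For fixed $\alpha\ne0$ (not depending on $\nu$) no $D_\alpha$ is a bound on the whole range $\nu\ge1/2$, $x>0$ that is as sharp there as $D_0$ (among upper bounds) or $D_{2\nu-1}$ (among lower bounds). More precisely, let $\alpha\neq0$ be fixed. If $K_{\nu-1}(x)/K_\nu(x)\le D_\alpha(\nu,x)$ for all $\nu\ge1/2$, $x>0$, then $D_0(\nu,x)<D_\alpha(\nu,x)$ for all $\nu\ge1/2$, $x>0$. If $D_\alpha(\nu,x)\le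 K_{\nu-1}(x)/K_\nu(x)$ for all $\nu\ge1/2$, $x>0$, then there is $\varepsilon>0$ such that $D_\alpha(\nu,x)<D_{2\nu-1}(\nu,x)$ for all $1/2\le\nu<1/2+\varepsilon$ and all $x>0$. (c) The upper bound $D_0$ improves the earlier upper bound $d_1$: for all $\nu\ge1/2$ and $x>0$, $$D_0(\nu,x)<d_1(\nu,x)=\frac{x}{\nu-1+\sqrt{(\nu-1)^2+x^2}} .$$ -/

import Mathlib

open MeasureTheory Set

noncomputable section

/-- The modified Bessel function of the second kind (Macdonald function) `K_ν(x)` of real order `ν`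
at `x > 0`: `K_ν(x) = ∫_0^∞ exp (-x cosh t) cosh (ν t) dt`. The integral converges absolutely
for every real `ν` and every `x > 0`. -/
def besselK (ν x : ℝ) : ℝ :=
  ∫ t in Ioi (0 : ℝ), Real.exp (-x * Real.cosh t) * Real.cosh (ν * t)

/-- The shifted order `τ = ν - (α + 1) / 2`. -/
def tauShift (α ν : ℝ) : ℝ := ν - (α + 1) / 2

/-- `d_α(ν, x) = x / (τ + √(τ² + x²))`, the family of bounds of the first stage. -/
def dBound (α ν x : ℝ) : ℝ :=
  x / (tauShift α ν + √(tauShift α ν ^ 2 + x ^ 2))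

/-- `φ_α(ν, x) = ν - 1/2 - τ / (2 √(τ² + x²))`. -/
def phiShift (α ν x : ℝ) : ℝ :=
  ν - 1 / 2 - tauShift α ν / (2 * √(tauShift α ν ^ 2 + x ^ 2))

/-- `D_α(ν, x) = x / (φ_α(ν, x) + √(φ_α(ν, x)² + x²))`, the family obtained by iterating. -/
def DBound (α ν x : ℝ) : ℝ :=
  x / (phiShift α ν x + √(phiShift α ν x ^ 2 + x ^ 2))

end

open Filter Topology

/-! ### Integrability and positivity of the integrand -/

/-! The ratio h = K_{ν-1}/K_ν solves the Riccati equation h' = h² + (2ν-1)h/x - 1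
(`hasDerivAt_besselK_ratio`). If h ever touched or crossed a strict barrier in the wrong direction,
the gap u would satisfy u' > g u with g ≥ c > 0 and become unbounded
(`not_bddAbove_of_mul_lt_deriv`), although h and the lower barrier lie in (0, 1] and the upper
barrier is positive. The lower barrier D_{2ν-1} is the positive root R of the right-hand side.
Replacing h'/h in the equation by R'/R yields the upper barrier D_0, and `phi_deriv_lt` shows that
it is a strict subsolution. For the comparisons, D_α is strictly decreasing in α, and at ν = 1/2 the
ratio and D_0 both equal 1, which fixes the sign of α. -/

lemma abs_le_mul_sq_add_sq_div {x : ℝ} (hx : 0 < x) (ν t : ℝ) :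
    |ν * t| ≤ x / 4 * t ^ 2 + ν ^ 2 / x := by
  have h : x / 4 * t ^ 2 + ν ^ 2 / x - |ν * t| = (x / 2 * |t| - |ν|) ^ 2 / x := by
    rw [abs_mul, ← sq_abs t, ← sq_abs ν]
    field_simp
    ring
  have : 0 ≤ (x / 2 * |t| - |ν|) ^ 2 / x := by positivity
  linarith

lemma sq_div_two_le_cosh (t : ℝ) : t ^ 2 / 2 ≤ Real.cosh t := by
  have h := Real.cosh_two_mul (t / 2)
  rw [show 2 * (t / 2) = t by ring, Real.cosh_sq] at h
  have h2 : (t / 2) ^ 2 ≤ Real.sinh (t / 2) ^ 2 := by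
    rw [sq_le_sq]
    rcases le_total 0 (t / 2) with h0 | h0
    · rw [abs_of_nonneg h0, abs_of_nonneg (Real.sinh_nonneg_iff.2 h0)]
      exact Real.self_le_sinh_iff.2 h0
    · rw [abs_of_nonpos h0, abs_of_nonpos (Real.sinh_nonpos_iff.2 h0)]
      exact neg_le_neg (Real.sinh_le_self_iff.2 h0)
  nlinarith

lemma cosh_le_exp_abs (t : ℝ) : Real.cosh t ≤ Real.exp |t| := by
  rw [Real.cosh_eq]
  have h1 := Real.exp_le_exp.2 (le_abs_self t)
  have h2 := Real.exp_le_exp.2 (neg_le_abs t)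
  linarith

/-- Of the decay x t²/2 coming from cosh t ≥ t²/2, half absorbs |νt| and half remains as a Gaussian
majorant. -/
lemma exp_neg_mul_cosh_mul_cosh_le {x : ℝ} (hx : 0 < x) (ν t : ℝ) :
    Real.exp (-x * Real.cosh t) * Real.cosh (ν * t) ≤
      Real.exp (ν ^ 2 / x) * Real.exp (-(x / 4) * t ^ 2) := by
  refine (mul_le_mul_of_nonneg_left (cosh_le_exp_abs _) (Real.exp_pos _).le).trans ?_
  rw [← Real.exp_add, ← Real.exp_add, Real.exp_le_exp]
  have h1 := abs_le_mul_sq_add_sq_div hx ν t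
  have h2 := mul_le_mul_of_nonneg_left (sq_div_two_le_cosh t) hx.le
  linarith

lemma integrableOn_besselK {x : ℝ} (hx : 0 < x) (ν : ℝ) :
    IntegrableOn (fun t ↦ Real.exp (-x * Real.cosh t) * Real.cosh (ν * t)) (Ioi 0) := by
  have h := ((integrable_exp_neg_mul_sq (show 0 < x / 4 by positivity)).const_mul
    (Real.exp (ν ^ 2 / x))).integrableOn (s := Ioi 0)
  refine h.mono' (by fun_prop) (ae_of_all _ fun t ↦ ?_)
  rw [Real.norm_of_nonneg (mul_nonneg (Real.exp_pos _).le (Real.cosh_pos _).le)]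
  exact exp_neg_mul_cosh_mul_cosh_le hx ν t

lemma besselK_pos {x : ℝ} (hx : 0 < x) (ν : ℝ) : 0 < besselK ν x := by
  have hpos : ∀ t, 0 < Real.exp (-x * Real.cosh t) * Real.cosh (ν * t) := fun t ↦
    mul_pos (Real.exp_pos _) (Real.cosh_pos _)
  refine (setIntegral_pos_iff_support_of_nonneg_ae (ae_of_all _ fun t ↦ (hpos t).le)
    (integrableOn_besselK hx ν)).2 ?_
  have : Function.support (fun t ↦ Real.exp (-x * Real.cosh t) * Real.cosh (ν * t)) = univ :=
    eq_univ_of_forall fun t ↦ (hpos t).ne'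
  rw [this, univ_inter, Real.volume_Ioi]
  exact ENNReal.zero_lt_top

lemma besselK_neg (ν x : ℝ) : besselK (-ν) x = besselK ν x := by
  simp only [besselK, neg_mul ν, Real.cosh_neg]

lemma besselK_le_besselK {x : ℝ} (hx : 0 < x) {μ ν : ℝ} (h : |μ| ≤ |ν|) :
    besselK μ x ≤ besselK ν x := by
  refine setIntegral_mono (integrableOn_besselK hx μ) (integrableOn_besselK hx ν) fun t ↦ ?_
  refine mul_le_mul_of_nonneg_left (Real.cosh_le_cosh.2 ?_) (Real.exp_pos _).le
  rw [abs_mul, abs_mul]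
  exact mul_le_mul_of_nonneg_right h (abs_nonneg t)

/-! ### Recurrence and derivative -/

lemma two_mul_cosh_mul_cosh (ν t : ℝ) :
    2 * (Real.cosh t * Real.cosh (ν * t)) =
      Real.cosh ((ν + 1) * t) + Real.cosh ((ν - 1) * t) := by
  rw [add_mul, sub_mul, one_mul, Real.cosh_add, Real.cosh_sub]
  ring

lemma two_mul_sinh_mul_sinh (ν t : ℝ) :
    2 * (Real.sinh t * Real.sinh (ν * t)) =
      Real.cosh ((ν + 1) * t) - Real.cosh ((ν - 1) * t) := by
  rw [add_mul, sub_mul, one_mul, Real.cosh_add, Real.cosh_sub]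
  ring

lemma tendsto_exp_neg_mul_cosh_mul_sinh {x : ℝ} (hx : 0 < x) (ν : ℝ) :
    Tendsto (fun t ↦ Real.exp (-x * Real.cosh t) * Real.sinh (ν * t)) atTop (𝓝 0) := by
  have hlim : Tendsto (fun t : ℝ ↦ Real.exp (ν ^ 2 / x) * Real.exp (-(x / 4) * t ^ 2))
      atTop (𝓝 0) := by
    rw [← mul_zero (Real.exp (ν ^ 2 / x))]
    refine (Real.tendsto_exp_atBot.comp ?_).const_mul _
    exact (tendsto_pow_atTop two_ne_zero).const_mul_atTop_of_neg (by linarith)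
  refine squeeze_zero_norm (fun t ↦ ?_) hlim
  refine le_trans ?_ (exp_neg_mul_cosh_mul_cosh_le hx ν t)
  rw [norm_mul, Real.norm_of_nonneg (Real.exp_pos _).le, Real.norm_eq_abs]
  refine mul_le_mul_of_nonneg_left ?_ (Real.exp_pos _).le
  refine abs_le_of_sq_le_sq ?_ (Real.cosh_pos _).le
  rw [Real.cosh_sq]
  linarith

/-- Integrate the derivative of exp(-x cosh t) sinh(νt), which vanishes at 0 and at infinity. -/
lemma besselK_recurrence {x : ℝ} (hx : 0 < x) (ν : ℝ) :
    x * (besselK (ν + 1) x - besselK (ν - 1) x) = 2 * ν * besselK ν x := by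
  set F : ℝ → ℝ → ℝ := fun μ t ↦ Real.exp (-x * Real.cosh t) * Real.cosh (μ * t) with hF
  have hi : ∀ μ, Integrable (fun t ↦ F μ t) (volume.restrict (Ioi 0)) :=
    integrableOn_besselK hx
  have hi2 : Integrable (fun t ↦ F (ν + 1) t - F (ν - 1) t) (volume.restrict (Ioi 0)) :=
    (hi _).sub (hi _)
  have hd : ∀ t ∈ Ici (0 : ℝ),
      HasDerivAt (fun t ↦ Real.exp (-x * Real.cosh t) * Real.sinh (ν * t))
        (ν * F ν t - x / 2 * (F (ν + 1) t - F (ν - 1) t)) t := fun t _ ↦ by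
    have h1 : HasDerivAt (fun t ↦ Real.exp (-x * Real.cosh t))
        (Real.exp (-x * Real.cosh t) * (-x * Real.sinh t)) t :=
      ((Real.hasDerivAt_cosh t).const_mul (-x)).exp
    have h2 : HasDerivAt (fun t ↦ Real.sinh (ν * t)) (Real.cosh (ν * t) * (ν * 1)) t :=
      ((hasDerivAt_id t).const_mul ν).sinh
    refine (h1.mul h2).congr_deriv ?_
    have h3 := two_mul_sinh_mul_sinh ν t
    simp only [hF]
    linear_combination (-x / 2 * Real.exp (-x * Real.cosh t)) * h3
  have hint := integral_Ioi_of_hasDerivAt_of_tendsto' hd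
    (((hi ν).const_mul ν).sub (hi2.const_mul (x / 2)))
    (tendsto_exp_neg_mul_cosh_mul_sinh hx ν)
  rw [integral_sub ((hi ν).const_mul ν) (hi2.const_mul (x / 2)),
    integral_const_mul, integral_const_mul, integral_sub (hi (ν + 1)) (hi (ν - 1))] at hint
  simp only [mul_zero, Real.sinh_zero, sub_zero] at hint
  simp only [besselK]
  linarith

lemma hasDerivAt_besselK {x : ℝ} (hx : 0 < x) (ν : ℝ) :
    HasDerivAt (besselK ν) (-(besselK (ν + 1) x + besselK (ν - 1) x) / 2) x := by
  have hi := fun {y : ℝ} (hy : 0 < y) ↦ integrableOn_besselK hy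
  have hprod : ∀ y t : ℝ, Real.exp (-y * Real.cosh t) * (Real.cosh t * Real.cosh (ν * t)) =
      2⁻¹ * (Real.exp (-y * Real.cosh t) * Real.cosh ((ν + 1) * t) +
        Real.exp (-y * Real.cosh t) * Real.cosh ((ν - 1) * t)) := fun y t ↦ by
    linear_combination (2⁻¹ * Real.exp (-y * Real.cosh t)) * two_mul_cosh_mul_cosh ν t
  have hx2 : 0 < x / 2 := by positivity
  -- For y > x/2 the y-derivative is dominated by its size at x/2, which `hprod` splits into two
  -- integrable Macdonald integrands.
  have key := hasDerivAt_integral_of_dominated_loc_of_deriv_le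
    (μ := volume.restrict (Ioi (0 : ℝ))) (x₀ := x) (s := Ioi (x / 2))
    (F := fun y t ↦ Real.exp (-y * Real.cosh t) * Real.cosh (ν * t))
    (F' := fun y t ↦ -(Real.exp (-y * Real.cosh t) * (Real.cosh t * Real.cosh (ν * t))))
    (bound := fun t ↦ Real.exp (-(x / 2) * Real.cosh t) * (Real.cosh t * Real.cosh (ν * t)))
    (Ioi_mem_nhds (by linarith)) (Eventually.of_forall fun y ↦ by fun_prop) (hi hx ν)
    (by fun_prop) (ae_of_all _ fun t y hy ↦ ?_) ?_ (ae_of_all _ fun t y _ ↦ ?_)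
  · refine key.2.congr_deriv ?_
    simp only [hprod]
    rw [integral_neg, integral_const_mul, integral_add (hi hx _) (hi hx _)]
    simp only [besselK]
    ring
  · have hc : 0 < Real.cosh t * Real.cosh (ν * t) :=
      mul_pos (Real.cosh_pos _) (Real.cosh_pos _)
    rw [norm_neg, Real.norm_of_nonneg (mul_nonneg (Real.exp_pos _).le hc.le)]
    refine mul_le_mul_of_nonneg_right (Real.exp_le_exp.2 ?_) hc.le
    exact mul_le_mul_of_nonneg_right (neg_le_neg (mem_Ioi.1 hy).le) (Real.cosh_pos _).le
  · simp only [hprod]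
    exact ((hi hx2 _).add (hi hx2 _)).const_mul _
  · have h1 : HasDerivAt (fun y ↦ Real.exp (-y * Real.cosh t))
        (Real.exp (-y * Real.cosh t) * (-1 * Real.cosh t)) y :=
      ((hasDerivAt_id y).neg.mul_const (Real.cosh t)).exp
    refine (h1.mul_const (Real.cosh (ν * t))).congr_deriv ?_
    ring

/-- The Riccati equation for the ratio of two consecutive Macdonald functions. -/
lemma hasDerivAt_besselK_ratio {x : ℝ} (hx : 0 < x) (ν : ℝ) :
    HasDerivAt (fun y ↦ besselK (ν - 1) y / besselK ν y)
      ((besselK (ν - 1) x / besselK ν x) ^ 2 +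
        (2 * ν - 1) / x * (besselK (ν - 1) x / besselK ν x) - 1) x := by
  have hK := (besselK_pos hx ν).ne'
  refine ((hasDerivAt_besselK hx (ν - 1)).div (hasDerivAt_besselK hx ν) hK).congr_deriv ?_
  have r1 := besselK_recurrence hx ν
  have r2 := besselK_recurrence hx (ν - 1)
  rw [sub_add_cancel] at r2 ⊢
  -- The recurrence at ν and at ν - 1 eliminates the outer orders ν + 1 and ν - 2.
  have e1 : besselK (ν + 1) x = besselK (ν - 1) x + 2 * ν * besselK ν x / x := by
    field_simp
    linarith
  have e2 : besselK (ν - 1 - 1) x = besselK ν x - 2 * (ν - 1) * besselK (ν - 1) x / x := by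
    field_simp
    linarith
  rw [e1, e2]
  field_simp
  ring

lemma besselK_ratio_pos {x : ℝ} (hx : 0 < x) (ν : ℝ) :
    0 < besselK (ν - 1) x / besselK ν x :=
  div_pos (besselK_pos hx _) (besselK_pos hx _)

lemma besselK_ratio_le_one {x ν : ℝ} (hx : 0 < x) (hν : 1 / 2 ≤ ν) :
    besselK (ν - 1) x / besselK ν x ≤ 1 := by
  rw [div_le_one (besselK_pos hx ν)]
  refine besselK_le_besselK hx ?_
  rw [abs_of_nonneg (show 0 ≤ ν by linarith), abs_le]
  constructor <;> linarith

lemma besselK_ratio_half {x : ℝ} (hx : 0 < x) :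
    besselK (1 / 2 - 1) x / besselK (1 / 2) x = 1 := by
  rw [show (1 / 2 - 1 : ℝ) = -(1 / 2) by norm_num, besselK_neg,
    div_self (besselK_pos hx _).ne']

/-! ### A growth argument -/

/-- At a zero of u the hypothesis gives u' > 0, so u cannot become negative. Then u' > c u ≥ 0 makes
u increasing, with slope eventually bounded below. -/
lemma not_bddAbove_of_mul_lt_deriv {u u' g : ℝ → ℝ} {a c : ℝ} (hc : 0 < c)
    (hu : ∀ x, a ≤ x → HasDerivAt u (u' x) x) (hlt : ∀ x, a ≤ x → g x * u x < u' x)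
    (hg : ∀ x, a ≤ x → c ≤ g x) (ha : 0 ≤ u a) (C : ℝ) : ∃ x, a ≤ x ∧ C < u x := by
  have hnonneg : ∀ x, a ≤ x → 0 ≤ u x := fun b hb ↦ by
    have := image_le_of_deriv_right_lt_deriv_boundary' (f := fun x ↦ -u x)
      (f' := fun x ↦ -u' x) (a := a) (b := b) (B := fun _ ↦ 0) (B' := fun _ ↦ 0)
      (fun x hx ↦ (hu x hx.1).neg.continuousAt.continuousWithinAt)
      (fun x hx ↦ (hu x hx.1).neg.hasDerivWithinAt) (by simpa using ha)
      continuousOn_const (fun x _ ↦ hasDerivWithinAt_const x _ _)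
      (fun x hx h0 ↦ by
        have h := hlt x hx.1
        have h0' : u x = 0 := by simpa using h0
        rw [h0', mul_zero] at h
        exact neg_lt_zero.2 h)
      (right_mem_Icc.2 hb)
    simpa using this
  have hcu : ∀ x, a ≤ x → c * u x < u' x := fun x hx ↦
    (mul_le_mul_of_nonneg_right (hg x hx) (hnonneg x hx)).trans_lt (hlt x hx)
  have hcont : ContinuousOn u (Ici a) := fun x hx ↦
    (hu x hx).continuousAt.continuousWithinAt
  have hmono : StrictMonoOn u (Ici a) := by
    refine strictMonoOn_of_deriv_pos (convex_Ici a) hcont fun x hx ↦ ?_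
    have hx' : a ≤ x := interior_subset hx
    rw [(hu x hx').deriv]
    exact (mul_nonneg hc.le (hnonneg x hx')).trans_lt (hcu x hx')
  -- Since u a may be 0, linear growth is measured from a + 1, where u is strictly positive.
  have ha1 : a ≤ a + 1 := by linarith
  have hδ : 0 < u (a + 1) :=
    ha.trans_lt (hmono (self_mem_Ici) ha1 (by linarith))
  set δ := u (a + 1) with hδdef
  have hgrow : ∀ y, a + 1 ≤ y → c * δ * (y - (a + 1)) ≤ u y - δ := fun y hy ↦ by
    refine (convex_Ici (a + 1)).mul_sub_le_image_sub_of_le_deriv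
      (hcont.mono (Ici_subset_Ici.2 ha1))
      (fun x hx ↦ (hu x (ha1.trans (interior_subset hx))).differentiableAt.differentiableWithinAt)
      (fun x hx ↦ ?_) _ self_mem_Ici _ hy hy
    have hx1 : a + 1 ≤ x := interior_subset hx
    rw [(hu x (ha1.trans hx1)).deriv]
    refine le_trans (mul_le_mul_of_nonneg_left ?_ hc.le) (hcu x (ha1.trans hx1)).le
    exact hmono.monotoneOn ha1 (ha1.trans hx1) hx1
  have hC : 0 ≤ |C| / (c * δ) := by positivity
  refine ⟨a + 1 + |C| / (c * δ), by linarith, ?_⟩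
  have h := hgrow (a + 1 + |C| / (c * δ)) (by linarith)
  have h2 : c * δ * (a + 1 + |C| / (c * δ) - (a + 1)) = |C| := by
    field_simp
    ring
  have := le_abs_self C
  linarith

/-! ### The positive root of `D² + 2 φ D / x = 1` -/

/-- The positive root `D` of `D² + 2 φ D / x = 1`. -/
noncomputable def rootBound (φ x : ℝ) : ℝ := x / (φ + √(φ ^ 2 + x ^ 2))

lemma DBound_eq_rootBound (α ν x : ℝ) : DBound α ν x = rootBound (phiShift α ν x) x := rfl

lemma abs_lt_sqrt_sq_add_sq {x : ℝ} (hx : 0 < x) (φ : ℝ) : |φ| < √(φ ^ 2 + x ^ 2) := by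
  rw [← Real.sqrt_sq_eq_abs]
  exact Real.sqrt_lt_sqrt (sq_nonneg _) (by nlinarith)

lemma add_sqrt_sq_add_sq_pos {x : ℝ} (hx : 0 < x) (φ : ℝ) : 0 < φ + √(φ ^ 2 + x ^ 2) := by
  have := abs_lt_sqrt_sq_add_sq hx φ
  have := neg_abs_le φ
  linarith

lemma rootBound_pos {x : ℝ} (hx : 0 < x) (φ : ℝ) : 0 < rootBound φ x :=
  div_pos hx (add_sqrt_sq_add_sq_pos hx φ)

lemma rootBound_eq {x : ℝ} (hx : 0 < x) (φ : ℝ) :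
    rootBound φ x = (√(φ ^ 2 + x ^ 2) - φ) / x := by
  have h := add_sqrt_sq_add_sq_pos hx φ
  have hs := Real.sq_sqrt (show 0 ≤ φ ^ 2 + x ^ 2 by positivity)
  rw [rootBound, div_eq_div_iff h.ne' hx.ne']
  linarith

lemma rootBound_sq_add {x : ℝ} (hx : 0 < x) (φ : ℝ) :
    rootBound φ x ^ 2 + 2 * φ / x * rootBound φ x = 1 := by
  have hs := Real.sq_sqrt (show 0 ≤ φ ^ 2 + x ^ 2 by positivity)
  rw [rootBound_eq hx]
  field_simp
  linarith

lemma rootBound_zero {x : ℝ} (hx : 0 < x) : rootBound 0 x = 1 := by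
  simp [rootBound, Real.sqrt_sq hx.le, hx.ne']

lemma rootBound_strictAnti {x : ℝ} (hx : 0 < x) : StrictAnti fun φ ↦ rootBound φ x := by
  intro a b hab
  have ha := rootBound_sq_add hx a
  have hb := rootBound_sq_add hx b
  have pa := rootBound_pos hx a
  have pb := rootBound_pos hx b
  by_contra! hle
  have h1 : rootBound a x ^ 2 ≤ rootBound b x ^ 2 := pow_le_pow_left₀ pa.le hle 2
  have h2 : 2 * a / x * rootBound a x < 2 * b / x * rootBound a x :=
    mul_lt_mul_of_pos_right (by gcongr) pa
  have h3 : (rootBound b x - rootBound a x) * (rootBound b x + rootBound a x + 2 * b / x) < 0 := by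
    nlinarith
  have h4 : 0 < rootBound b x + 2 * b / x := by
    -- The quadratic equation factors as D (D + 2φ/x) = 1, so the second factor is positive whatever
    -- the sign of φ.
    have : rootBound b x * (rootBound b x + 2 * b / x) = 1 := by linarith
    exact pos_of_mul_pos_right (this ▸ one_pos) pb.le
  nlinarith [mul_nonneg (sub_nonneg.2 hle) (add_pos h4 pa).le]

lemma hasDerivAt_rootBound {x φ' : ℝ} {φ : ℝ → ℝ} (hx : 0 < x) (hφ : HasDerivAt φ φ' x) :
    HasDerivAt (fun y ↦ rootBound (φ y) y)
      (rootBound (φ x) x / x * ((φ x - x * φ') / √(φ x ^ 2 + x ^ 2))) x := by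
  have hpos : 0 < φ x ^ 2 + x ^ 2 := by positivity
  have hS : 0 < √(φ x ^ 2 + x ^ 2) := Real.sqrt_pos.2 hpos
  have hs := Real.sq_sqrt hpos.le
  have h1 := ((hφ.pow 2).add ((hasDerivAt_id x).pow 2)).sqrt hpos.ne'
  have h2 := (h1.sub hφ).div (hasDerivAt_id x) hx.ne'
  have heq : (fun y ↦ rootBound (φ y) y) =ᶠ[𝓝 x] fun y ↦ (√(φ y ^ 2 + y ^ 2) - φ y) / y := by
    filter_upwards [Ioi_mem_nhds hx] with y hy using rootBound_eq hy _
  refine (HasDerivAt.congr_of_eventuallyEq (h2.congr_deriv ?_) heq)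
  rw [rootBound_eq hx]
  simp only [Pi.add_apply, Pi.pow_apply, Pi.sub_apply, id]
  set S := √(φ x ^ 2 + x ^ 2)
  norm_num
  field_simp
  linear_combination (-1) * hs

/-! ### The bounds for `ν > 1/2` -/

/-- Supplies the uniform constant c in the growth argument. -/
lemma rootBound_mono_right {lam a x : ℝ} (hl : 0 ≤ lam) (ha : 0 < a) (h : a ≤ x) :
    rootBound lam a ≤ rootBound lam x := by
  have hx : 0 < x := ha.trans_le h
  refine (monotoneOn_of_deriv_nonneg (convex_Ioi 0) (f := fun y ↦ rootBound lam y)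
    (fun y hy ↦ ?_) (fun y hy ↦ ?_) fun y hy ↦ ?_) ha hx h
  · exact (hasDerivAt_rootBound hy (hasDerivAt_const y lam)).continuousAt.continuousWithinAt
  · exact (hasDerivAt_rootBound (interior_subset hy)
      (hasDerivAt_const y lam)).differentiableAt.differentiableWithinAt
  · have hy : 0 < y := interior_subset hy
    rw [(hasDerivAt_rootBound hy (hasDerivAt_const y lam)).deriv]
    have := rootBound_pos hy lam
    rw [mul_zero, sub_zero]
    positivity

/-- A strict subsolution of the Riccati equation, given as a root, is a strict upper bound. -/
lemma besselK_ratio_lt_of_deriv_lt {ν x₀ : ℝ} {φ φ' : ℝ → ℝ} (hν : 1 / 2 < ν) (hx₀ : 0 < x₀)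
    (hφ : ∀ x, 0 < x → HasDerivAt φ (φ' x) x) (hle : ∀ x, 0 < x → φ x ≤ ν - 1 / 2)
    (hlt : ∀ x, 0 < x → (φ x - x * φ' x) / √(φ x ^ 2 + x ^ 2) < 2 * ν - 1 - 2 * φ x) :
    besselK (ν - 1) x₀ / besselK ν x₀ < rootBound (φ x₀) x₀ := by
  by_contra! hcon
  set h := fun y ↦ besselK (ν - 1) y / besselK ν y with hh
  refine absurd (not_bddAbove_of_mul_lt_deriv (a := x₀)
    (u := fun y ↦ h y - rootBound (φ y) y)
    (u' := fun y ↦ (h y ^ 2 + (2 * ν - 1) / y * h y - 1) -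
      rootBound (φ y) y / y * ((φ y - y * φ' y) / √(φ y ^ 2 + y ^ 2)))
    (g := fun y ↦ h y + rootBound (φ y) y + (2 * ν - 1) / y)
    (rootBound_pos hx₀ (ν - 1 / 2))
    (fun y hy ↦ (hasDerivAt_besselK_ratio (hx₀.trans_le hy) ν).sub
      (hasDerivAt_rootBound (hx₀.trans_le hy) (hφ y (hx₀.trans_le hy))))
    (fun y hy ↦ ?_) (fun y hy ↦ ?_) (sub_nonneg.2 hcon) 1) ?_
  rotate_left 2
  · rintro ⟨x, hx, hC⟩
    have hx0 := hx₀.trans_le hx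
    have h1 : h x ≤ 1 := besselK_ratio_le_one hx0 hν.le
    have h2 := rootBound_pos hx0 (φ x)
    linarith
  · have hy0 := hx₀.trans_le hy
    have h1 := rootBound_sq_add hy0 (φ y)
    have h2 := mul_lt_mul_of_pos_left (hlt y hy0) (div_pos (rootBound_pos hy0 (φ y)) hy0)
    -- By the quadratic equation, this is the Riccati right-hand side evaluated at the root.
    have h3 : rootBound (φ y) y / y * (2 * ν - 1 - 2 * φ y) =
      (2 * ν - 1) / y * rootBound (φ y) y - 2 * φ y / y * rootBound (φ y) y := by ring
    nlinarith
  · have hy0 := hx₀.trans_le hy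
    have h1 : 0 < h y := besselK_ratio_pos hy0 ν
    have h2 : rootBound (ν - 1 / 2) x₀ ≤ rootBound (φ y) y :=
      (rootBound_mono_right (by linarith) hx₀ hy).trans
        ((rootBound_strictAnti hy0).antitone (hle y hy0))
    have h3 : 0 ≤ (2 * ν - 1) / y := div_nonneg (by linarith) hy0.le
    linarith

/-- On this root the Riccati right-hand side vanishes while the root itself strictly increases in x,
so it is a strict supersolution. -/
lemma rootBound_lt_besselK_ratio {ν x₀ : ℝ} (hν : 1 / 2 < ν) (hx₀ : 0 < x₀) :
    rootBound (ν - 1 / 2) x₀ < besselK (ν - 1) x₀ / besselK ν x₀ := by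
  by_contra! hcon
  set h := fun y ↦ besselK (ν - 1) y / besselK ν y with hh
  have hl : 0 < ν - 1 / 2 := by linarith
  refine absurd (not_bddAbove_of_mul_lt_deriv (a := x₀)
    (u := fun y ↦ rootBound (ν - 1 / 2) y - h y)
    (u' := fun y ↦ rootBound (ν - 1 / 2) y / y *
      (((ν - 1 / 2) - y * 0) / √((ν - 1 / 2) ^ 2 + y ^ 2)) -
        (h y ^ 2 + (2 * ν - 1) / y * h y - 1))
    (g := fun y ↦ h y + rootBound (ν - 1 / 2) y + (2 * ν - 1) / y)
    (rootBound_pos hx₀ (ν - 1 / 2))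
    (fun y hy ↦ (hasDerivAt_rootBound (hx₀.trans_le hy)
      (hasDerivAt_const y (ν - 1 / 2))).sub (hasDerivAt_besselK_ratio (hx₀.trans_le hy) ν))
    (fun y hy ↦ ?_) (fun y hy ↦ ?_) (sub_nonneg.2 hcon) 1) ?_
  rotate_left 2
  · rintro ⟨x, hx, hC⟩
    have hx0 := hx₀.trans_le hx
    have h1 : 0 < h x := besselK_ratio_pos hx0 ν
    have h2 : rootBound (ν - 1 / 2) x < rootBound 0 x := rootBound_strictAnti hx0 hl
    rw [rootBound_zero hx0] at h2
    linarith
  · have hy0 := hx₀.trans_le hy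
    have h1 := rootBound_sq_add hy0 (ν - 1 / 2)
    rw [show 2 * (ν - 1 / 2) = 2 * ν - 1 by ring] at h1
    have h2 : 0 < rootBound (ν - 1 / 2) y / y *
        (((ν - 1 / 2) - y * 0) / √((ν - 1 / 2) ^ 2 + y ^ 2)) := by
      have := rootBound_pos hy0 (ν - 1 / 2)
      rw [mul_zero, sub_zero]
      positivity
    nlinarith
  · have hy0 := hx₀.trans_le hy
    have h1 : 0 < h y := besselK_ratio_pos hy0 ν
    have h2 := rootBound_mono_right hl.le hx₀ hy
    have h3 : 0 ≤ (2 * ν - 1) / y := div_nonneg (by linarith) hy0.le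
    linarith

lemma hasDerivAt_phiShift (α ν : ℝ) {x : ℝ} (hx : 0 < x) :
    HasDerivAt (phiShift α ν)
      (tauShift α ν * x / (2 * √(tauShift α ν ^ 2 + x ^ 2) ^ 3)) x := by
  have hpos : 0 < tauShift α ν ^ 2 + x ^ 2 := by positivity
  have hS : 0 < √(tauShift α ν ^ 2 + x ^ 2) := Real.sqrt_pos.2 hpos
  have h1 := ((hasDerivAt_const x (tauShift α ν ^ 2)).add ((hasDerivAt_id x).pow 2)).sqrt hpos.ne'
  have h2 := ((hasDerivAt_const x (tauShift α ν)).div (h1.const_mul 2)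
    (mul_pos two_pos hS).ne').const_sub (ν - 1 / 2)
  refine h2.congr_deriv ?_
  simp only [Pi.add_apply, Pi.pow_apply, id]
  set S := √(tauShift α ν ^ 2 + x ^ 2)
  norm_num
  field_simp

/-- With `s = √(lam² + x²)` and `φ = lam - lam / (2 s)`, the root for `φ` is a strict subsolution of
the Riccati equation. -/
lemma phi_deriv_lt {lam x s : ℝ} (hl : 0 < lam) (hx : 0 < x) (hs : 0 < s)
    (hs2 : s ^ 2 = lam ^ 2 + x ^ 2) :
    (lam - lam / (2 * s) - x * (lam * x / (2 * s ^ 3))) /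
      √((lam - lam / (2 * s)) ^ 2 + x ^ 2) < lam / s := by
  set q := lam ^ 2 / s ^ 2 with hq
  have hq0 : 0 < q := by positivity
  have hq1 : q < 1 := by
    rw [hq, div_lt_one (by positivity)]
    nlinarith
  have hx2 : x ^ 2 = s ^ 2 - lam ^ 2 := by linarith
  have hR : (lam - lam / (2 * s)) ^ 2 + x ^ 2 = s ^ 2 - q * s + q / 4 := by
    rw [hx2, hq]
    field_simp
    ring
  have hL : lam - lam / (2 * s) - x * (lam * x / (2 * s ^ 3)) = lam / s * (s - 1 + q / 2) := by
    rw [show x * (lam * x / (2 * s ^ 3)) = lam * x ^ 2 / (2 * s ^ 3) by ring, hx2, hq]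
    field_simp
    ring
  have hpos : 0 < (lam - lam / (2 * s)) ^ 2 + x ^ 2 := by positivity
  -- After cancelling lam / s, the claim is s - 1 + q/2 < √(s² - q s + q/4).
  rw [hL, div_lt_iff₀ (Real.sqrt_pos.2 hpos)]
  refine mul_lt_mul_of_pos_left ?_ (by positivity)
  rw [hR] at hpos ⊢
  rcases le_or_gt (s - 1 + q / 2) 0 with h0 | h0
  · exact h0.trans_lt (Real.sqrt_pos.2 hpos)
  · refine Real.lt_sqrt_of_sq_lt ?_
    -- This product is exactly the difference of the two squares; `h0` gives 2s - 1 > 1 - q > 0.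
    have : 0 < (1 - q) * (2 * s - 1 + q / 4) := mul_pos (by linarith) (by linarith)
    nlinarith

lemma besselK_ratio_lt_DBound_zero {ν x : ℝ} (hν : 1 / 2 < ν) (hx : 0 < x) :
    besselK (ν - 1) x / besselK ν x < DBound 0 ν x := by
  have hτ : tauShift 0 ν = ν - 1 / 2 := by simp [tauShift]
  have hl : 0 < ν - 1 / 2 := by linarith
  rw [DBound_eq_rootBound]
  refine besselK_ratio_lt_of_deriv_lt hν hx (fun y hy ↦ hasDerivAt_phiShift 0 ν hy)
    (fun y hy ↦ ?_) fun y hy ↦ ?_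
  · rw [phiShift, hτ]
    exact sub_le_self _ (by positivity)
  · have hpos : 0 < (ν - 1 / 2) ^ 2 + y ^ 2 := by positivity
    have h := phi_deriv_lt hl hy (Real.sqrt_pos.2 hpos) (Real.sq_sqrt hpos.le)
    rw [phiShift, hτ]
    refine h.trans_eq ?_
    field_simp
    ring

/-! ### Comparison within the family -/

lemma div_sqrt_sq_add_sq_strictMono {x : ℝ} (hx : 0 < x) :
    StrictMono fun τ : ℝ ↦ τ / √(τ ^ 2 + x ^ 2) := by
  have hd : ∀ τ : ℝ, HasDerivAt (fun τ : ℝ ↦ τ / √(τ ^ 2 + x ^ 2))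
      (x ^ 2 / √(τ ^ 2 + x ^ 2) ^ 3) τ := fun τ ↦ by
    have hpos : 0 < τ ^ 2 + x ^ 2 := by positivity
    have hS : 0 < √(τ ^ 2 + x ^ 2) := Real.sqrt_pos.2 hpos
    have hs := Real.sq_sqrt hpos.le
    have h1 := (((hasDerivAt_id τ).pow 2).add (hasDerivAt_const τ (x ^ 2))).sqrt hpos.ne'
    refine ((hasDerivAt_id τ).div h1 hS.ne').congr_deriv ?_
    simp only [Pi.add_apply, Pi.pow_apply, id]
    set S := √(τ ^ 2 + x ^ 2)
    norm_num
    field_simp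
    linarith
  refine strictMono_of_deriv_pos fun τ ↦ ?_
  have hpos : 0 < τ ^ 2 + x ^ 2 := by positivity
  rw [(hd τ).deriv]
  positivity

/-- Raising α lowers τ, hence lowers τ/√(τ² + x²) and raises φ. -/
lemma DBound_strictAnti (ν : ℝ) {x : ℝ} (hx : 0 < x) : StrictAnti fun α ↦ DBound α ν x := by
  intro α β h
  refine rootBound_strictAnti hx ?_
  have hτ : tauShift β ν < tauShift α ν := by
    unfold tauShift
    linarith
  have h1 := div_sqrt_sq_add_sq_strictMono hx hτ
  have h2 : ∀ a b : ℝ, a / (2 * b) = a / b / 2 := fun a b ↦ by rw [mul_comm, div_mul_eq_div_div]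
  simp only [phiShift, h2]
  dsimp only at h1
  linarith

lemma DBound_two_mul_sub_one (ν x : ℝ) : DBound (2 * ν - 1) ν x = rootBound (ν - 1 / 2) x := by
  have hτ : tauShift (2 * ν - 1) ν = 0 := by
    unfold tauShift
    ring
  rw [DBound_eq_rootBound, phiShift, hτ, zero_div, sub_zero]

lemma DBound_zero_half {x : ℝ} (hx : 0 < x) : DBound 0 (1 / 2) x = 1 := by
  have h := DBound_two_mul_sub_one (1 / 2) x
  norm_num at h
  rw [rootBound_zero hx] at h
  norm_num
  exact h

/-- Since d_1 is the root for ν - 1, it suffices that the correction subtracted from ν - 1/2 is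
below 1/2. -/
lemma DBound_zero_lt_dBound_one (ν : ℝ) {x : ℝ} (hx : 0 < x) : DBound 0 ν x < dBound 1 ν x := by
  refine rootBound_strictAnti hx ?_
  have h := abs_lt_sqrt_sq_add_sq hx (tauShift 0 ν)
  have h1 : tauShift 0 ν / (2 * √(tauShift 0 ν ^ 2 + x ^ 2)) < 1 / 2 := by
    rw [div_lt_iff₀ (by linarith [abs_nonneg (tauShift 0 ν)])]
    linarith [le_abs_self (tauShift 0 ν)]
  have h2 : tauShift 1 ν = ν - 1 := by
    unfold tauShift
    ring
  rw [h2, phiShift]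
  linarith

theorem theorem9 :
    -- the two bounds, with equality exactly at `ν = 1/2`
    (∀ ν : ℝ, 1 / 2 ≤ ν → ∀ x : ℝ, 0 < x →
      DBound (2 * ν - 1) ν x ≤ besselK (ν - 1) x / besselK ν x ∧
      besselK (ν - 1) x / besselK ν x ≤ DBound 0 ν x ∧
      (DBound (2 * ν - 1) ν x = besselK (ν - 1) x / besselK ν x ↔ ν = 1 / 2) ∧
      (besselK (ν - 1) x / besselK ν x = DBound 0 ν x ↔ ν = 1 / 2)) ∧
    -- every other upper bound of the family on `ν ≥ 1/2` is weaker than the one for `α = 0`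
    (∀ α : ℝ, α ≠ 0 →
      (∀ ν : ℝ, 1 / 2 ≤ ν → ∀ x : ℝ, 0 < x → besselK (ν - 1) x / besselK ν x ≤ DBound α ν x) →
      ∀ ν : ℝ, 1 / 2 ≤ ν → ∀ x : ℝ, 0 < x → DBound 0 ν x < DBound α ν x) ∧
    -- no lower bound of the family with fixed `α ≠ 0` on `ν ≥ 1/2` is as sharp as `D_{2ν-1}` there:
    -- it is strictly weaker for all `x > 0` and all `ν` close enough to `1/2`
    (∀ α : ℝ, α ≠ 0 →
      (∀ ν : ℝ, 1 / 2 ≤ ν → ∀ x : ℝ, 0 < x → DBound α ν x ≤ besselK (ν - 1) x / besselK ν x) →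
      ∃ ε : ℝ, 0 < ε ∧ ∀ ν : ℝ, 1 / 2 ≤ ν → ν < 1 / 2 + ε → ∀ x : ℝ, 0 < x →
        DBound α ν x < DBound (2 * ν - 1) ν x) ∧
    -- the new upper bound improves the upper bound `d_1`
    (∀ ν : ℝ, 1 / 2 ≤ ν → ∀ x : ℝ, 0 < x → DBound 0 ν x < dBound 1 ν x) := by
  refine ⟨fun ν hν x hx ↦ ?_, fun α hα h ν _ x hx ↦ ?_, fun α hα h ↦ ?_,
    fun ν _ x hx ↦ DBound_zero_lt_dBound_one ν hx⟩
  · rw [DBound_two_mul_sub_one]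
    rcases hν.eq_or_lt with rfl | hν
    · rw [besselK_ratio_half hx, sub_self, rootBound_zero hx, DBound_zero_half hx]
      simp
    · have h1 := rootBound_lt_besselK_ratio hν hx
      have h2 := besselK_ratio_lt_DBound_zero hν hx
      exact ⟨h1.le, h2.le, iff_of_false h1.ne hν.ne', iff_of_false h2.ne hν.ne'⟩
  -- Testing at ν = 1/2, x = 1, where the ratio equals D_0, forces α < 0.
  · have h1 := h (1 / 2) le_rfl 1 one_pos
    rw [besselK_ratio_half one_pos] at h1
    replace h1 := (DBound_zero_half one_pos).trans_le h1
    exact DBound_strictAnti ν hx (((DBound_strictAnti (1 / 2) one_pos).le_iff_ge.1 h1).lt_of_ne hα)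
  · have h1 := h (1 / 2) le_rfl 1 one_pos
    rw [besselK_ratio_half one_pos] at h1
    replace h1 := h1.trans_eq (DBound_zero_half one_pos).symm
    have hα0 : 0 < α := ((DBound_strictAnti (1 / 2) one_pos).le_iff_ge.1 h1).lt_of_ne' hα
    -- The condition ν < 1/2 + α/2 says precisely that 2ν - 1 < α.
    refine ⟨α / 2, by positivity, fun ν _ hν x hx ↦ DBound_strictAnti ν hx ?_⟩
    linarith
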